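/- Let $d\ge 1$. There is a constant $C_d$, depending only on $d$, such that the following holds. Let $\mathbb{F}$ be an arbitrary field and let $\mathcal{L}^\ast$ be the family of all (affine) lines in $\mathbb{F}^d$. For $x\in\mathbb{F}^d$ and $l_1,\dots,l_d\in\mathcal{L}^\ast$, let $\delta(x,l_1,\dots,l_d)=1$ if $x$ lies on each of $l_1,\dots,l_d$ and the directions of $l_1,\dots,l_d$ are linearly independent, and let $\delta(x,l_1,\dots,l_d)=0$ otherwise. Then for every finitely supported $M:\mathbb{F}^d\to[0,\infty)$ there is a function $g:\mathbb{F}^d\times\mathcal{L}^\ast\to[0,\infty)$ such that for all $x\in\mathbb{F}^d$ and all $l_1,\dots,l_d\in\mathcal{L}^\ast$ $$M(x)^d\,\delta(x,l_1,\dots,l_d)\le g(x,l_1)\cdots g(x,l_d),$$ and for all $l\in\mathcal{L}^\ast$ $$\sum_{x\in l} g(x,l)\le C_d\Big(\sum_{x\in\mathbb{F}^d}M(x)^d\Big)^{1/d}$$ (in particular the sum on the left converges). -/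

import Mathlib

open scoped NNReal

namespace Joints

/-- The family of all lines in `F ^ d`: nonempty affine subspaces with one-dimensional
direction. -/
def Line (F : Type*) [Field F] (d : ℕ) : Type _ :=
  {l : AffineSubspace F (Fin d → F) //
    (l : Set (Fin d → F)).Nonempty ∧ Module.finrank F l.direction = 1}

/-- The lines `l 0, …, l (d - 1)` form a joint at `x`: they all pass through `x`, and their
directions are linearly independent. A vector lying in the direction of a line and belonging to
a linearly independent family is nonzero, hence it spans that direction. -/
def FormJoint {F : Type*} [Field F] {d : ℕ} (x : Fin d → F) (l : Fin d → Line F d) : Prop :=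
  (∀ i, x ∈ (l i).1) ∧
    ∃ v : Fin d → (Fin d → F), (∀ i, v i ∈ (l i).1.direction) ∧ LinearIndependent F v

open Classical in
/-- The multijoints kernel `δ(x, l₁, …, l_d)`. -/
noncomputable def jointKernel {F : Type*} [Field F] {d : ℕ}
    (x : Fin d → F) (l : Fin d → Line F d) : ℝ≥0 :=
  if FormJoint x l then 1 else 0

end Joints

/-!
The function `g` comes from the polynomial method. Let `S` be the support of `M`, and give each
point `x` of `S` a natural number `α x`, its handicap. On a line `l`, impose on polynomials of
degree at most `n` the conditions of vanishing to higher and higher order at the points of `S ∩ l`,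
the condition of order `s` at `y` coming at time `s - α y`, until more than `n` conditions are in
force. The number of conditions that fall to `x` is `fillDepth (pointsOn S l) α n x`, and the sum of
these numbers over `x ∈ S ∩ l` is about `n` (`sum_fillDepth_le`). The function `g (x, l)` is this
number multiplied by a constant times `(∑ x, M x ^ d) ^ (1 / d) / n`.

For lower bounds, choose a joint at each point `x` of `S`. A polynomial in `d` variables of degree
at most `n` vanishes identically once its Taylor coefficients at each `x` vanish, in the coordinates
of the joint at `x`, for all exponents in the box whose sides are the depths of the `d` lines
(`eq_zero_of_taylor_coeff_eq_zero`). Comparing dimensions shows that, whatever the handicaps and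
the joints are, the products of the depths add up to at least a constant times `n ^ d`
(`pow_card_le_sum_prod_fillDepth`, `pow_le_sum_minDepth`).

Finally the handicaps are adjusted so that this total is distributed over the points in proportion
to `M x ^ d` (`exists_handicap_le_minDepth`). Raising the handicap of `x` can only increase the
depths at `x` and decrease the others. Any two points lie on a common line, so a point
whose handicap is far below that of another has depth zero on some line, which prevents the
handicaps from drifting apart. For `n` large compared with the number of points, all rounding errors are negligible.
-/

namespace Joints

/-! ### Vanishing conditions on a line -/

section FillDepth

variable {ι : Type*}

/-- The number of vanishing conditions that a point `x` of the finite set `Y` imposes on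
polynomials of degree at most `n` in one variable, when the conditions are imposed in the order
given by the handicaps `α`: the condition of order `s` at `y` comes at time `s - α y`, and the
process stops once more than `n` conditions are in force; simultaneous conditions are all imposed.
The truncated difference `r + α y - α x` counts the conditions at `y` which come strictly before
the condition of order `r` at `x`. -/
noncomputable def fillDepth (Y : Finset ι) (α : ι → ℕ) (n : ℕ) (x : ι) : ℕ :=
  sInf {r | n < ∑ y ∈ Y, (r + α y - α x)}

variable {Y : Finset ι} {α : ι → ℕ} {n : ℕ} {x : ι}

lemma fillDepth_le {r : ℕ} (h : n < ∑ y ∈ Y, (r + α y - α x)) : fillDepth Y α n x ≤ r :=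
  Nat.sInf_le h

lemma lt_sum_of_mem {r : ℕ} (hx : x ∈ Y) (hr : n < r) : n < ∑ y ∈ Y, (r + α y - α x) :=
  hr.trans_le <| by
    simpa using Finset.single_le_sum (f := fun y => r + α y - α x) (fun _ _ => Nat.zero_le _) hx

lemma fillDepth_le_succ (hx : x ∈ Y) : fillDepth Y α n x ≤ n + 1 :=
  fillDepth_le (lt_sum_of_mem hx n.lt_succ_self)

lemma lt_sum_fillDepth (hx : x ∈ Y) : n < ∑ y ∈ Y, (fillDepth Y α n x + α y - α x) :=
  Nat.sInf_mem (s := {r | n < ∑ y ∈ Y, (r + α y - α x)}) ⟨n + 1, lt_sum_of_mem hx n.lt_succ_self⟩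

lemma lt_sum_of_fillDepth_le {r : ℕ} (hx : x ∈ Y) (hr : fillDepth Y α n x ≤ r) :
    n < ∑ y ∈ Y, (r + α y - α x) :=
  (lt_sum_fillDepth (α := α) (n := n) hx).trans_le (Finset.sum_le_sum fun y _ => by omega)

lemma sum_le_of_lt_fillDepth {r : ℕ} (hr : r < fillDepth Y α n x) :
    ∑ y ∈ Y, (r + α y - α x) ≤ n :=
  not_lt.1 (Nat.notMem_of_lt_sInf (s := {r | n < ∑ y ∈ Y, (r + α y - α x)}) hr)

/-- A point whose handicap is much smaller than that of another point is never reached. -/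
lemma fillDepth_eq_zero {y : ι} (hy : y ∈ Y) (h : n + α x < α y) : fillDepth Y α n x = 0 := by
  refine Nat.le_zero.1 (fillDepth_le ?_)
  have := Finset.single_le_sum (f := fun y => 0 + α y - α x) (fun _ _ => Nat.zero_le _) hy
  exact lt_of_lt_of_le (by omega) this

/-- The depths of the points of `Y` add up to essentially `n`; the error `Y.card` comes from
conditions that are imposed simultaneously. -/
lemma sum_fillDepth_le : ∑ x ∈ Y, fillDepth Y α n x ≤ n + Y.card := by
  classical
  rcases (Y.filter fun x => 0 < fillDepth Y α n x).eq_empty_or_nonempty with h | h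
  · rw [Finset.filter_eq_empty_iff] at h
    rw [Finset.sum_eq_zero fun x hx => by simpa using h hx]
    exact Nat.zero_le _
  -- Compare with the point at which the last condition is imposed.
  obtain ⟨x, hx, hmax⟩ := Finset.exists_max_image _
    (fun x => (fillDepth Y α n x : ℤ) - α x) h
  simp only [Finset.mem_filter, and_imp] at hx hmax
  have hlt := sum_le_of_lt_fillDepth (Nat.sub_lt hx.2 one_pos)
  calc ∑ y ∈ Y, fillDepth Y α n y
      ≤ ∑ y ∈ Y, ((fillDepth Y α n x - 1 + α y - α x) + 1) := by
        refine Finset.sum_le_sum fun y hy => ?_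
        rcases Nat.eq_zero_or_pos (fillDepth Y α n y) with h0 | h0
        · omega
        · have := hmax y hy h0
          omega
    _ ≤ n + Y.card := by
        rw [Finset.sum_add_distrib, Finset.card_eq_sum_ones]
        omega

variable [DecidableEq ι]

/-- Raising the handicap of one point does not increase the depth of the others. -/
lemma fillDepth_update_le {y : ι} (hx : x ∈ Y) (hxy : x ≠ y) :
    fillDepth Y (Function.update α y (α y + 1)) n x ≤ fillDepth Y α n x := by
  refine fillDepth_le ((lt_sum_fillDepth (α := α) (n := n) hx).trans_le
    (Finset.sum_le_sum fun z _ => ?_))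
  rw [Function.update_of_ne hxy]
  rcases eq_or_ne z y with rfl | hz
  · rw [Function.update_self]; omega
  · rw [Function.update_of_ne hz]

/-- Raising the handicap of a point by one increases its own depth by at most one. -/
lemma fillDepth_update_self_le (hx : x ∈ Y) :
    fillDepth Y (Function.update α x (α x + 1)) n x ≤ fillDepth Y α n x + 1 := by
  refine fillDepth_le ((lt_sum_fillDepth (α := α) (n := n) hx).trans_le
    (Finset.sum_le_sum fun z _ => ?_))
  rw [Function.update_self]
  rcases eq_or_ne z x with rfl | hz
  · rw [Function.update_self]; omega
  · rw [Function.update_of_ne hz]; omega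

end FillDepth

/-! ### Taylor expansions and slices of polynomials -/

section Polynomials

open MvPolynomial Finset

section AffineSubst

variable {F σ : Type*} [Field F] [Fintype σ]

/-- Substitution of affine coordinates: `affineSubst x A p` is the polynomial
`u ↦ p (x + ∑ i, u i • A i)`, that is, `p` written in the coordinates with origin `x` and
basis given by the rows of `A`. -/
noncomputable def affineSubst (x : σ → F) (A : Matrix σ σ F) :
    MvPolynomial σ F →ₐ[F] MvPolynomial σ F :=
  aeval fun j => C (x j) + ∑ i, C (A i j) * X i

lemma affineSubst_X (x : σ → F) (A : Matrix σ σ F) (j : σ) :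
    affineSubst x A (X j) = C (x j) + ∑ i, C (A i j) * X i := by
  simp [affineSubst]

lemma affineSubst_affineSubst (x y : σ → F) (A B : Matrix σ σ F) (p : MvPolynomial σ F) :
    affineSubst y B (affineSubst x A p) =
      affineSubst (x + Matrix.vecMul y A) (B * A) p := by
  suffices (affineSubst y B).comp (affineSubst x A) =
      affineSubst (x + Matrix.vecMul y A) (B * A) from DFunLike.congr_fun this p
  refine algHom_ext fun j => ?_
  simp only [AlgHom.comp_apply, affineSubst_X, map_add, map_sum, map_mul, algHom_C,
    algebraMap_eq, Pi.add_apply, Matrix.vecMul, dotProduct, Matrix.mul_apply, mul_add,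
    Finset.sum_add_distrib, Finset.mul_sum, Finset.sum_mul, add_assoc]
  congr 1
  congr 1
  · exact Finset.sum_congr rfl fun i _ => mul_comm _ _
  · rw [Finset.sum_comm]
    exact Finset.sum_congr rfl fun i _ => Finset.sum_congr rfl fun k _ => by ring

lemma affineSubst_zero_mem_pow_idealOfVars (A : Matrix σ σ F) {r : ℕ} {p : MvPolynomial σ F}
    (hp : p ∈ idealOfVars σ F ^ r) : affineSubst 0 A p ∈ idealOfVars σ F ^ r := by
  have hle : (idealOfVars σ F).map (affineSubst 0 A) ≤ idealOfVars σ F := by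
    rw [idealOfVars, Ideal.map_span, Ideal.span_le]
    rintro _ ⟨_, ⟨j, rfl⟩, rfl⟩
    rw [affineSubst_X]
    simp only [Pi.zero_apply, map_zero, zero_add]
    exact Ideal.sum_mem _ fun i _ => Ideal.mul_mem_left _ _ (Ideal.subset_span ⟨i, rfl⟩)
  have := Ideal.mem_map_of_mem (affineSubst 0 A) hp
  rw [Ideal.map_pow] at this
  exact Ideal.pow_right_mono hle r this

lemma totalDegree_affineSubst_le (x : σ → F) (A : Matrix σ σ F) (p : MvPolynomial σ F) :
    (affineSubst x A p).totalDegree ≤ p.totalDegree := by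
  have hlin : ∀ j, (C (x j) + ∑ i, C (A i j) * X i : MvPolynomial σ F).totalDegree ≤ 1 := by
    intro j
    refine (totalDegree_add _ _).trans (max_le (by simp) ?_)
    refine totalDegree_finsetSum_le fun i _ => (totalDegree_mul _ _).trans ?_
    simp
  rw [affineSubst, aeval_def, eval₂_eq]
  refine totalDegree_finsetSum_le fun m hm => (totalDegree_mul _ _).trans ?_
  rw [algebraMap_eq, totalDegree_C, zero_add]
  refine (totalDegree_finsetProd _ _).trans (le_trans ?_ (le_totalDegree hm))
  refine Finset.sum_le_sum fun i _ => (totalDegree_pow _ _).trans ?_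
  simpa using Nat.mul_le_mul_left (m i) (hlin i)

variable [DecidableEq σ]

lemma affineSubst_zero_one (p : MvPolynomial σ F) : affineSubst 0 1 p = p := by
  suffices affineSubst (0 : σ → F) 1 = AlgHom.id F _ from DFunLike.congr_fun this p
  refine algHom_ext fun j => ?_
  simp [affineSubst_X, Matrix.one_apply]

lemma affineSubst_injective (x : σ → F) {A : Matrix σ σ F} (hA : IsUnit A) :
    Function.Injective (affineSubst x A) := by
  have hdet := (Matrix.isUnit_iff_isUnit_det A).1 hA
  refine Function.LeftInverse.injective
    (g := affineSubst (-(Matrix.vecMul x A⁻¹)) A⁻¹) fun p => ?_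
  rw [affineSubst_affineSubst, Matrix.nonsing_inv_mul _ hdet, Matrix.neg_vecMul,
    Matrix.vecMul_vecMul, Matrix.nonsing_inv_mul _ hdet, Matrix.vecMul_one, add_neg_cancel,
    affineSubst_zero_one]

/-- The order of vanishing at `x` does not depend on the basis used for the Taylor expansion. -/
lemma affineSubst_mem_pow_idealOfVars (x : σ → F) {A : Matrix σ σ F} (hA : IsUnit A)
    (B : Matrix σ σ F) {r : ℕ} {p : MvPolynomial σ F}
    (hp : affineSubst x A p ∈ idealOfVars σ F ^ r) :
    affineSubst x B p ∈ idealOfVars σ F ^ r := by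
  have hdet := (Matrix.isUnit_iff_isUnit_det A).1 hA
  have := affineSubst_zero_mem_pow_idealOfVars (B * A⁻¹) hp
  rwa [affineSubst_affineSubst, Matrix.zero_vecMul, add_zero, Matrix.mul_assoc,
    Matrix.nonsing_inv_mul _ hdet, Matrix.mul_one] at this

end AffineSubst

section Slice

variable {F σ : Type*} [Field F] [DecidableEq σ]

/-- The polynomial `p` as a polynomial in the variables other than `i`, with coefficients that are
univariate polynomials in the variable `i`. (The variable `i` itself no longer occurs on the outer
level.) -/
noncomputable def sliceHom (i : σ) : MvPolynomial σ F →ₐ[F] MvPolynomial σ (Polynomial F) :=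
  aeval fun j => if j = i then C Polynomial.X else X j

lemma sliceHom_X_self (i : σ) : sliceHom (F := F) i (X i) = C Polynomial.X := by
  simp [sliceHom]

lemma sliceHom_X_of_ne {i j : σ} (h : j ≠ i) : sliceHom (F := F) i (X j) = X j := by
  simp [sliceHom, h]

lemma sliceHom_monomial (i : σ) (m : σ →₀ ℕ) (a : F) :
    sliceHom i (monomial m a) = monomial (m.erase i) (Polynomial.monomial (m i) a) := by
  have hm : monomial m a = monomial (m.erase i) a * X i ^ m i := by
    rw [X_pow_eq_monomial, monomial_mul, mul_one, Finsupp.erase_add_single]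
  have he : sliceHom i (monomial (m.erase i) a) = monomial (m.erase i) (Polynomial.C a) := by
    rw [sliceHom, aeval_monomial, monomial_eq (a := Polynomial.C a)]
    congr 1
    refine Finsupp.prod_congr fun j hj => ?_
    rw [Finsupp.support_erase, Finset.mem_erase] at hj
    rw [if_neg hj.1]
  rw [hm, map_mul, map_pow, sliceHom_X_self, he, ← C_pow, mul_comm, C_mul_monomial, mul_comm,
    Polynomial.C_mul_X_pow_eq_monomial]

lemma coeff_coeff_sliceHom {i : σ} {e : σ →₀ ℕ} (he : e i = 0) (k : ℕ) (p : MvPolynomial σ F) :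
    ((sliceHom i p).coeff e).coeff k = p.coeff (e + Finsupp.single i k) := by
  induction p using MvPolynomial.induction_on' with
  | add p q hp hq => rw [map_add, coeff_add, Polynomial.coeff_add, hp, hq, coeff_add]
  | monomial m a =>
    rw [sliceHom_monomial, coeff_monomial, coeff_monomial]
    by_cases h : m = e + Finsupp.single i k
    · have h1 : m.erase i = e := by
        subst h; ext j; by_cases hj : j = i <;> simp [hj, he]
      have h2 : m i = k := by simp [h, he]
      rw [if_pos h1, if_pos h, h2, Polynomial.coeff_monomial_same]
    · rw [if_neg h]
      split_ifs with h1
      · rw [Polynomial.coeff_monomial, if_neg]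
        rintro rfl
        exact h (by rw [← h1, Finsupp.erase_add_single])
      · simp

variable [Fintype σ]

/-- Translating a polynomial along the axis `i` translates its slices in that direction. -/
lemma coeff_sliceHom_translate (i : σ) (c : F) (e : σ →₀ ℕ) (p : MvPolynomial σ F) :
    (sliceHom i (affineSubst (Pi.single i c) 1 p)).coeff e =
      ((sliceHom i p).coeff e).comp (Polynomial.X + Polynomial.C c) := by
  have key : ((sliceHom i).comp (affineSubst (Pi.single i c) 1)).toRingHom =
      (MvPolynomial.map (Polynomial.compRingHom (Polynomial.X + Polynomial.C c))).comp
        (sliceHom (F := F) i).toRingHom := by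
    refine MvPolynomial.ringHom_ext (fun a => ?_) fun j => ?_
    · simp [sliceHom, affineSubst, MvPolynomial.algebraMap_apply]
    · simp only [AlgHom.toRingHom_eq_coe, RingHom.coe_coe, AlgHom.comp_apply, RingHom.comp_apply,
        affineSubst_X]
      have hs : ∑ k, C ((1 : Matrix σ σ F) k j) * X k = (X j : MvPolynomial σ F) := by
        simp [Matrix.one_apply]
      rw [hs, map_add]
      by_cases hj : j = i
      · subst hj
        rw [sliceHom_X_self]
        simp [sliceHom, MvPolynomial.algebraMap_apply, add_comm]
      · rw [sliceHom_X_of_ne hj]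
        simp [hj]
  have := congr_arg (fun f => (f p).coeff e) key
  simpa [coeff_map] using this

end Slice

/-! ### The vanishing lemma and the dimension count -/

section Vanishing

variable {F σ : Type*} [Field F]

lemma polynomial_eq_zero_of_pow_dvd {ι : Type*} {q : Polynomial F} {n : ℕ} (hq : q.natDegree ≤ n)
    {Y : Finset ι} {c : ι → F} (hc : Set.InjOn c Y) {s : ι → ℕ}
    (hdvd : ∀ y ∈ Y, (Polynomial.X - Polynomial.C (c y)) ^ s y ∣ q) (hn : n < ∑ y ∈ Y, s y) :
    q = 0 := by
  have hprod : ∏ y ∈ Y, (Polynomial.X - Polynomial.C (c y)) ^ s y ∣ q := by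
    refine Finset.prod_dvd_of_coprime (fun y hy z hz hyz => ?_) hdvd
    refine IsCoprime.pow (Polynomial.isCoprime_X_sub_C_of_isUnit_sub ?_)
    exact (sub_ne_zero.2 fun h => hyz (hc hy hz h)).isUnit
  refine Polynomial.eq_zero_of_dvd_of_natDegree_lt hprod (hq.trans_lt ?_)
  rw [Polynomial.natDegree_prod_of_monic _ _ fun y _ => (Polynomial.monic_X_sub_C _).pow _]
  simpa using hn

variable [DecidableEq σ] [Fintype σ]

/-- The vanishing lemma. If all Taylor coefficients of `p` at the points `x ∈ S` with exponents in
the box with side lengths `fillDepth (Y x i) α n x` vanish, then `p = 0`. Here `Y x i` consists of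
points of `S` on the `i`-th axis through `x`.

The reason is that at the point `x` where the order of vanishing minus the handicap is least, a
monomial of lowest degree has an exponent that leaves the box in some direction `i`. The slice of
`p` through that monomial along the `i`-th axis then has more zeros than its degree allows. -/
theorem eq_zero_of_taylor_coeff_eq_zero {S : Finset (σ → F)} (hS : S.Nonempty)
    (α : (σ → F) → ℕ) {A : (σ → F) → Matrix σ σ F} (hA : ∀ x ∈ S, IsUnit (A x)) {n : ℕ}
    {Y : (σ → F) → σ → Finset (σ → F)} (hYS : ∀ x ∈ S, ∀ i, Y x i ⊆ S)
    (hself : ∀ x ∈ S, ∀ i, x ∈ Y x i)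
    (hline : ∀ x ∈ S, ∀ i, ∀ y ∈ Y x i, ∃ c : F, y = x + c • A x i)
    {p : MvPolynomial σ F} (hp : p.totalDegree ≤ n)
    (hcoeff : ∀ x ∈ S, ∀ e : σ →₀ ℕ, (∀ i, e i < fillDepth (Y x i) α n x) →
      (affineSubst x (A x) p).coeff e = 0) :
    p = 0 := by
  by_contra hp0
  have hlow : ∀ x ∈ S, ∃ a : σ →₀ ℕ, (affineSubst x (A x) p).coeff a ≠ 0 ∧
      affineSubst x (A x) p ∈ idealOfVars σ F ^ a.degree := by
    intro x hx
    have hne : affineSubst x (A x) p ≠ 0 := fun h =>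
      hp0 (affineSubst_injective x (hA x hx) (by rw [h, map_zero]))
    obtain ⟨a, ha, hmin⟩ := Finset.exists_min_image _ Finsupp.degree (support_nonempty.2 hne)
    exact ⟨a, mem_support_iff.1 ha, (mem_pow_idealOfVars_iff _ _).2 hmin⟩
  choose! a ha hord using hlow
  obtain ⟨x, hx, hmin⟩ := Finset.exists_min_image S (fun x => ((a x).degree : ℤ) - α x) hS
  obtain ⟨i, hi⟩ : ∃ i, fillDepth (Y x i) α n x ≤ a x i := by
    by_contra! h
    exact ha x hx (hcoeff x hx (a x) h)
  choose! c hc using hline x hx i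
  set e := (a x).erase i with he
  have hei : e i = 0 := Finsupp.erase_same
  have hea : e + Finsupp.single i (a x i) = a x := Finsupp.erase_add_single i (a x)
  have hdeg : e.degree + a x i = (a x).degree := by
    conv_rhs => rw [← hea, map_add, Finsupp.degree_single]
  have hq : (sliceHom i (affineSubst x (A x) p)).coeff e = 0 := by
    refine polynomial_eq_zero_of_pow_dvd (n := n) (c := c)
      (s := fun y => a x i + α y - α x) ?_ ?_ ?_ (lt_sum_of_fillDepth_le (hself x hx i) hi)
    · refine Polynomial.natDegree_le_iff_coeff_eq_zero.2 fun k hk => ?_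
      rw [coeff_coeff_sliceHom hei]
      refine coeff_eq_zero_of_totalDegree_lt
        (((totalDegree_affineSubst_le x (A x) p).trans hp).trans_lt ?_)
      rw [← Finsupp.degree_apply, map_add, Finsupp.degree_single]
      omega
    · intro y hy z hz hyz
      rw [hc y hy, hc z hz, hyz]
    · intro y hy
      have hyS := hYS x hx i hy
      rw [Polynomial.X_sub_C_pow_dvd_iff, ← coeff_sliceHom_translate, affineSubst_affineSubst,
        Matrix.single_vecMul, one_mul]
      rw [Polynomial.X_pow_dvd_iff]
      intro k hk
      rw [coeff_coeff_sliceHom hei]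
      have hmem := affineSubst_mem_pow_idealOfVars y (hA y hyS) (A x) (hord y hyS)
      have hy' : x + c y • A x i = y := (hc y hy).symm
      have := (mem_pow_idealOfVars_iff' _ _).1 hmem (e + Finsupp.single i k) ?_
      · rwa [← hy'] at this
      · have := hmin y hyS
        rw [map_add, Finsupp.degree_single]
        omega
  apply ha x hx
  rw [← hea, ← coeff_coeff_sliceHom hei, hq, Polynomial.coeff_zero]

/-- Comparison of the dimension of a space of polynomials of degree at most `card σ * k` with the
number of vanishing conditions in `eq_zero_of_taylor_coeff_eq_zero`. -/
theorem pow_card_le_sum_prod_fillDepth {S : Finset (σ → F)} (hS : S.Nonempty)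
    (α : (σ → F) → ℕ) {A : (σ → F) → Matrix σ σ F} (hA : ∀ x ∈ S, IsUnit (A x)) (k : ℕ)
    {Y : (σ → F) → σ → Finset (σ → F)} (hYS : ∀ x ∈ S, ∀ i, Y x i ⊆ S)
    (hself : ∀ x ∈ S, ∀ i, x ∈ Y x i)
    (hline : ∀ x ∈ S, ∀ i, ∀ y ∈ Y x i, ∃ c : F, y = x + c • A x i) :
    (k + 1) ^ Fintype.card σ ≤
      ∑ x ∈ S, ∏ i, fillDepth (Y x i) α (Fintype.card σ * k) x := by
  set n := Fintype.card σ * k with hn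
  let expo : (σ → Fin (k + 1)) → (σ →₀ ℕ) := fun f =>
    Finsupp.equivFunOnFinite.symm fun i => (f i : ℕ)
  have hexpo : Function.Injective expo := by
    intro f g h
    have := Finsupp.equivFunOnFinite.symm.injective h
    exact funext fun i => Fin.ext (congr_fun this i)
  let P : ((σ → Fin (k + 1)) → F) →ₗ[F] MvPolynomial σ F :=
    Fintype.linearCombination F fun f => basisMonomials σ F (expo f)
  have hPinj : Function.Injective P := by
    refine LinearIndependent.fintypeLinearCombination_injective ?_
    exact (basisMonomials σ F).linearIndependent.comp expo hexpo
  have hPdeg : ∀ v, (P v).totalDegree ≤ n := by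
    intro v
    simp only [P, Fintype.linearCombination_apply]
    refine totalDegree_finsetSum_le fun f _ => (totalDegree_smul_le _ _).trans ?_
    rw [coe_basisMonomials]
    refine (totalDegree_monomial_le _ _).trans ?_
    change (expo f).degree ≤ n
    rw [Finsupp.degree_eq_sum]
    calc ∑ i, expo f i ≤ ∑ _i : σ, k :=
          Finset.sum_le_sum fun i _ => Nat.lt_succ_iff.1 (f i).isLt
      _ = n := by simp [hn]
  let Idx := Σ x : S, ∀ i, Fin (fillDepth (Y x i) α n x)
  let Φ : ((σ → Fin (k + 1)) → F) →ₗ[F] (Idx → F) :=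
    LinearMap.pi fun j => (lcoeff F (Finsupp.equivFunOnFinite.symm fun i => (j.2 i : ℕ))) ∘ₗ
      (affineSubst j.1.1 (A j.1)).toLinearMap ∘ₗ P
  have hΦ : Function.Injective Φ := by
    rw [injective_iff_map_eq_zero]
    intro v hv
    refine hPinj ?_
    rw [map_zero]
    refine eq_zero_of_taylor_coeff_eq_zero hS α hA hYS hself hline (hPdeg v) fun x hx e he => ?_
    have := congr_fun hv ⟨⟨x, hx⟩, fun i => ⟨e i, he i⟩⟩
    simpa [Φ] using this
  have := LinearMap.finrank_le_finrank_of_injective hΦ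
  rw [← Finset.sum_attach]
  simpa [Idx] using this

end Vanishing

end Polynomials

/-! ### Joints and the least product of depths -/

section Lines

variable {F : Type*} [Field F] {d : ℕ}

lemma Line.exists_eq_add_smul {l : Line F d} {x y v : Fin d → F} (hx : x ∈ l.1) (hy : y ∈ l.1)
    (hv : v ∈ l.1.direction) (hv0 : v ≠ 0) : ∃ c : F, y = x + c • v := by
  have hyx : y - x ∈ l.1.direction := AffineSubspace.vsub_mem_direction hy hx
  obtain ⟨c, hc⟩ := (finrank_eq_one_iff_of_nonzero' (⟨v, hv⟩ : l.1.direction)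
    (by simpa [Subtype.ext_iff] using hv0)).1 l.2.2 ⟨y - x, hyx⟩
  refine ⟨c, ?_⟩
  have : c • v = y - x := congr_arg Subtype.val hc
  rw [this, add_sub_cancel]

lemma exists_formJoint (x : Fin d → F) {v : Fin d → Fin d → F} (hv : LinearIndependent F v) :
    ∃ l : Fin d → Line F d, FormJoint x l ∧ ∀ i, x + v i ∈ (l i).1 := by
  have hdir (i : Fin d) : (AffineSubspace.mk' x (F ∙ v i)).direction = F ∙ v i :=
    AffineSubspace.direction_mk' _ _
  refine ⟨fun i => ⟨AffineSubspace.mk' x (F ∙ v i), ⟨x, AffineSubspace.self_mem_mk' _ _⟩, ?_⟩,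
    ⟨fun i => AffineSubspace.self_mem_mk' _ _, v, fun i => ?_, hv⟩, fun i => ?_⟩
  · rw [hdir, finrank_span_singleton (hv.ne_zero i)]
  · rw [hdir]
    exact Submodule.mem_span_singleton_self _
  · simp [AffineSubspace.mem_mk', Submodule.mem_span_singleton_self]

lemma exists_formJoint_through (x : Fin d → F) : ∃ l : Fin d → Line F d, FormJoint x l :=
  let ⟨l, hl, _⟩ := exists_formJoint x (Pi.basisFun F (Fin d)).linearIndependent
  ⟨l, hl⟩

/-- Any line through `x` is part of a joint at `x`. -/
lemma exists_formJoint_mem {x y : Fin d → F} (hxy : x ≠ y) :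
    ∃ l : Fin d → Line F d, FormJoint x l ∧ ∃ i, y ∈ (l i).1 := by
  obtain ⟨j, hj⟩ := Function.ne_iff.1 hxy
  have hli : LinearIndependent F (Function.update (Pi.basisFun F (Fin d)) j (y - x)) := by
    refine (Pi.basisFun F (Fin d)).linearIndependent.update j (y - x)
      ⟨1, one_mem _, (Pi.basisFun F (Fin d)).repr (y - x), ?_, ?_⟩
    · rw [mem_nonZeroDivisors_iff_ne_zero]
      simpa [sub_eq_zero] using hj.symm
    rw [one_smul, Module.Basis.linearCombination_repr]
  obtain ⟨l, hl, hmem⟩ := exists_formJoint x hli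
  exact ⟨l, hl, j, by simpa using hmem j⟩

end Lines

section Depth

variable {F : Type*} [Field F] {d : ℕ}

open Classical in
/-- The points of `S` on the line `l`. -/
noncomputable def pointsOn (S : Finset (Fin d → F)) (l : Line F d) : Finset (Fin d → F) :=
  S.filter (· ∈ l.1)

lemma mem_pointsOn {S : Finset (Fin d → F)} {l : Line F d} {x : Fin d → F} :
    x ∈ pointsOn S l ↔ x ∈ S ∧ x ∈ l.1 := by
  simp [pointsOn]

/-- The least product of the depths at `x` of the lines of a joint at `x`. -/
noncomputable def minDepth (S : Finset (Fin d → F)) (α : (Fin d → F) → ℕ) (n : ℕ)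
    (x : Fin d → F) : ℕ :=
  sInf {w | ∃ l : Fin d → Line F d, FormJoint x l ∧ ∏ i, fillDepth (pointsOn S (l i)) α n x = w}

variable {S : Finset (Fin d → F)} {α : (Fin d → F) → ℕ} {n : ℕ} {x : Fin d → F}

lemma minDepth_le {l : Fin d → Line F d} (hl : FormJoint x l) :
    minDepth S α n x ≤ ∏ i, fillDepth (pointsOn S (l i)) α n x :=
  Nat.sInf_le ⟨l, hl, rfl⟩

variable (S α n x) in
lemma exists_prod_eq_minDepth : ∃ l : Fin d → Line F d, FormJoint x l ∧
    ∏ i, fillDepth (pointsOn S (l i)) α n x = minDepth S α n x :=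
  Nat.sInf_mem (s := {w | ∃ l : Fin d → Line F d, FormJoint x l ∧
    ∏ i, fillDepth (pointsOn S (l i)) α n x = w})
    (let ⟨l, hl⟩ := exists_formJoint_through x; ⟨_, l, hl, rfl⟩)

lemma minDepth_eq_zero {y : Fin d → F} (hy : y ∈ S) (hxy : x ≠ y) (h : n + α x < α y) :
    minDepth S α n x = 0 := by
  obtain ⟨l, hl, i, hi⟩ := exists_formJoint_mem hxy
  refine Nat.le_zero.1 ((minDepth_le hl).trans_eq ?_)
  exact Finset.prod_eq_zero (Finset.mem_univ i)
    (fillDepth_eq_zero (mem_pointsOn.2 ⟨hy, hi⟩) h)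

theorem pow_le_sum_minDepth (hS : S.Nonempty) (α : (Fin d → F) → ℕ) (k : ℕ) :
    (k + 1) ^ d ≤ ∑ x ∈ S, minDepth S α (d * k) x := by
  choose l hl hprod using exists_prod_eq_minDepth S α (d * k)
  choose hmem v hv hli using hl
  have := pow_card_le_sum_prod_fillDepth hS α (A := fun x => Matrix.of (v x))
    (fun x _ => Matrix.linearIndependent_rows_iff_isUnit.1 (hli x)) k
    (Y := fun x i => pointsOn S (l x i)) (fun x _ i y hy => (mem_pointsOn.1 hy).1)
    (fun x hx i => mem_pointsOn.2 ⟨hx, hmem x i⟩)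
    (fun x _ i y hy => Line.exists_eq_add_smul (hmem x i) (mem_pointsOn.1 hy).2 (hv x i)
      ((hli x).ne_zero i))
  rw [Fintype.card_fin] at this
  simpa only [hprod] using this

variable [DecidableEq (Fin d → F)]

lemma minDepth_update_le {y : Fin d → F} (hx : x ∈ S) (hxy : x ≠ y) :
    minDepth S (Function.update α y (α y + 1)) n x ≤ minDepth S α n x := by
  obtain ⟨l, hl, hprod⟩ := exists_prod_eq_minDepth S α n x
  rw [← hprod]
  exact (minDepth_le hl).trans <| Finset.prod_le_prod' fun i _ =>
    fillDepth_update_le (mem_pointsOn.2 ⟨hx, hl.1 i⟩) hxy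

/-- The increase of a product of natural numbers below `N` when every factor increases by one. -/
lemma prod_succ_le {ι : Type*} (s : Finset ι) {b : ι → ℕ} {N : ℕ} (hb : ∀ i ∈ s, b i + 1 ≤ N) :
    ∏ i ∈ s, (b i + 1) ≤ ∏ i ∈ s, b i + s.card * N ^ (s.card - 1) := by
  classical
  induction s using Finset.induction_on with
  | empty => simp
  | insert a s ha ih =>
    rw [Finset.prod_insert ha, Finset.prod_insert ha, Finset.card_insert_of_notMem ha,
      Nat.add_sub_cancel]
    have hs : ∀ i ∈ s, b i + 1 ≤ N := fun i hi => hb i (Finset.mem_insert_of_mem hi)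
    have h1 : ∏ i ∈ s, (b i + 1) ≤ N ^ s.card := Finset.prod_le_pow_card _ _ _ hs
    have h2 : b a * (s.card * N ^ (s.card - 1)) ≤ s.card * N ^ s.card := by
      rcases Nat.eq_zero_or_pos s.card with h | h
      · simp [h]
      · calc b a * (s.card * N ^ (s.card - 1)) ≤ N * (s.card * N ^ (s.card - 1)) :=
              Nat.mul_le_mul_right _ ((Nat.le_succ _).trans (hb a (Finset.mem_insert_self a s)))
          _ = s.card * (N ^ (s.card - 1) * N) := by ring
          _ = s.card * N ^ s.card := by rw [pow_sub_one_mul h.ne']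
    calc (b a + 1) * ∏ i ∈ s, (b i + 1)
        = b a * ∏ i ∈ s, (b i + 1) + ∏ i ∈ s, (b i + 1) := by ring
      _ ≤ b a * (∏ i ∈ s, b i + s.card * N ^ (s.card - 1)) + N ^ s.card :=
          Nat.add_le_add (Nat.mul_le_mul_left _ (ih hs)) h1
      _ ≤ b a * ∏ i ∈ s, b i + (s.card + 1) * N ^ s.card := by
          rw [mul_add, add_mul, one_mul, add_assoc]
          exact Nat.add_le_add_left (Nat.add_le_add_right h2 _) _

lemma minDepth_update_self_le (hx : x ∈ S) :
    minDepth S (Function.update α x (α x + 1)) n x ≤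
      minDepth S α n x + d * (n + 2) ^ (d - 1) := by
  obtain ⟨l, hl, hprod⟩ := exists_prod_eq_minDepth S α n x
  rw [← hprod]
  have hmem (i : Fin d) : x ∈ pointsOn S (l i) := mem_pointsOn.2 ⟨hx, hl.1 i⟩
  calc minDepth S (Function.update α x (α x + 1)) n x
      ≤ ∏ i, fillDepth (pointsOn S (l i)) (Function.update α x (α x + 1)) n x := minDepth_le hl
    _ ≤ ∏ i, (fillDepth (pointsOn S (l i)) α n x + 1) :=
        Finset.prod_le_prod' fun i _ => fillDepth_update_self_le (hmem i)
    _ ≤ _ := by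
        simpa using prod_succ_le Finset.univ (N := n + 2)
          fun i _ => Nat.succ_le_succ (fillDepth_le_succ (α := α) (hmem i))

end Depth

/-! ### Choice of the handicaps -/

section Balancing

variable {F : Type*} [Field F] {d : ℕ}

/-- The handicaps can be chosen so that `minDepth` exceeds any prescribed positive weights whose
total is slightly smaller than the number of vanishing conditions.

Starting with zero handicaps, those of deficient points are raised in unit steps, always at a
deficient point of least handicap. A point that has been raised is never much above its weight, so
by `pow_le_sum_minDepth` some handicap remains zero. The other handicaps are then bounded by
`d * k + 1`, because a larger one would make `minDepth` vanish at a point of handicap zero. So the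
process stops; in the proof, its final state is a maximizer of the total handicap. -/
theorem exists_handicap_le_minDepth {S : Finset (Fin d → F)} (k : ℕ) {K : (Fin d → F) → ℝ}
    (hK : ∀ x ∈ S, 0 < K x)
    (hsum : ∑ x ∈ S, (K x + (d * (d * k + 2) ^ (d - 1) : ℕ)) ≤ ((k + 1) ^ d : ℕ)) :
    ∃ α : (Fin d → F) → ℕ, ∀ x ∈ S, K x ≤ minDepth S α (d * k) x := by
  classical
  rcases S.eq_empty_or_nonempty with rfl | hS
  · exact ⟨0, by simp⟩
  set n := d * k
  set ε : ℕ := d * (n + 2) ^ (d - 1)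
  let Adm (α : (Fin d → F) → ℕ) : Prop :=
    ∀ x ∈ S, α x ≤ n + 1 ∧ (0 < α x → (minDepth S α n x : ℝ) < K x + ε)
  have hzero (α : (Fin d → F) → ℕ)
      (h : ∀ x ∈ S, 0 < α x → (minDepth S α n x : ℝ) < K x + ε) : ∃ z ∈ S, α z = 0 := by
    by_contra! hpos
    have h1 : ((k + 1) ^ d : ℕ) ≤ ∑ x ∈ S, (minDepth S α n x : ℝ) := by
      exact_mod_cast pow_le_sum_minDepth hS α k
    have h2 : ∑ x ∈ S, (minDepth S α n x : ℝ) < ∑ x ∈ S, (K x + ε) :=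
      Finset.sum_lt_sum_of_nonempty hS fun x hx => h x hx (Nat.pos_of_ne_zero (hpos x hx))
    linarith
  -- The bound in `Adm` makes a maximizer exist; that a step preserves it follows from `hzero`
  -- and `minDepth_eq_zero`.
  obtain ⟨α, hα, hmax⟩ : ∃ α, Adm α ∧ ∀ β, Adm β → ∑ x ∈ S, β x ≤ ∑ x ∈ S, α x := by
    have hbdd : BddAbove {m | ∃ α, Adm α ∧ ∑ x ∈ S, α x = m} := by
      refine ⟨S.card * (n + 1), ?_⟩
      rintro _ ⟨α, hα, rfl⟩
      simpa using Finset.sum_le_card_nsmul S α (n + 1) fun x hx => (hα x hx).1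
    obtain ⟨α, hα, hsup⟩ := Nat.sSup_mem (s := {m | ∃ α, Adm α ∧ ∑ x ∈ S, α x = m})
      ⟨_, 0, fun x _ => by simp, rfl⟩ hbdd
    exact ⟨α, hα, fun β hβ => hsup ▸ le_csSup hbdd ⟨β, hβ, rfl⟩⟩
  refine ⟨α, ?_⟩
  by_contra! hbad
  obtain ⟨x, hx, hmin⟩ := Finset.exists_min_image
    (S.filter fun x => (minDepth S α n x : ℝ) < K x) α
    (let ⟨x, hx, h⟩ := hbad; ⟨x, Finset.mem_filter.2 ⟨hx, h⟩⟩)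
  simp only [Finset.mem_filter, and_imp] at hx hmin
  set β := Function.update α x (α x + 1) with hβ
  have hβx : β x = α x + 1 := Function.update_self ..
  have hβne {y} (hy : y ≠ x) : β y = α y := Function.update_of_ne hy ..
  have hβlt : ∀ y ∈ S, 0 < β y → (minDepth S β n y : ℝ) < K y + ε := by
    intro y hy hpos
    rcases eq_or_ne y x with rfl | hyx
    · have : (minDepth S β n y : ℝ) ≤ minDepth S α n y + ε := by
        exact_mod_cast minDepth_update_self_le hy
      linarith [hx.2]
    · have : (minDepth S β n y : ℝ) ≤ minDepth S α n y := by
        exact_mod_cast minDepth_update_le hy hyx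
      linarith [(hα y hy).2 (hβne hyx ▸ hpos)]
  have hβadm : Adm β := by
    refine fun y hy => ⟨?_, hβlt y hy⟩
    rcases eq_or_ne y x with rfl | hyx
    · obtain ⟨z, hz, hz0⟩ := hzero β hβlt
      have hzy : z ≠ y := by rintro rfl; omega
      rw [hβne hzy] at hz0
      by_contra! hlt
      have hz' := hmin z hz <| by
        rw [minDepth_eq_zero hy hzy (by omega), Nat.cast_zero]
        exact hK z hz
      omega
    · rw [hβne hyx]
      exact (hα y hy).1
  refine (hmax β hβadm).not_gt (Finset.sum_lt_sum (fun y _ => ?_) ⟨x, hx.1, by omega⟩)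
  rcases eq_or_ne y x with rfl | hyx
  · omega
  · rw [hβne hyx]

/-- Handicaps for which `minDepth` dominates, up to normalization, a given function. The degree
`d * k` is taken so large that rounding errors do not matter. -/
theorem exists_handicap_mul_le (hd : 1 ≤ d) {S : Finset (Fin d → F)} {m : (Fin d → F) → ℝ}
    (hm : ∀ x ∈ S, 0 < m x) :
    ∃ (k : ℕ) (α : (Fin d → F) → ℕ), S.card ≤ k ∧ ∀ x ∈ S,
      m x * (k + 1) ^ d ≤ 2 * (∑ y ∈ S, m y) * minDepth S α (d * k) x := by
  rcases S.eq_empty_or_nonempty with rfl | hS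
  · exact ⟨0, 0, by simp⟩
  set T := ∑ y ∈ S, m y
  have hT : 0 < T := Finset.sum_pos hm hS
  -- This `k` makes the total rounding error at most half of the dimension `(k + 1) ^ d`.
  set k : ℕ := S.card * (2 * d * (2 * d) ^ (d - 1)) with hk
  have hrounding : 2 * (S.card * (d * (d * k + 2) ^ (d - 1))) ≤ (k + 1) ^ d := by
    calc 2 * (S.card * (d * (d * k + 2) ^ (d - 1)))
        ≤ 2 * (S.card * (d * ((2 * d) * (k + 1)) ^ (d - 1))) := by
          gcongr
          nlinarith
      _ = k * (k + 1) ^ (d - 1) := by rw [hk, mul_pow]; ring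
      _ ≤ (k + 1) * (k + 1) ^ (d - 1) := Nat.mul_le_mul_right _ k.le_succ
      _ = (k + 1) ^ d := mul_pow_sub_one (by omega) _
  obtain ⟨α, hα⟩ := exists_handicap_le_minDepth (S := S) k
    (K := fun x => m x * (k + 1) ^ d / (2 * T)) (fun x hx => by have := hm x hx; positivity) <| by
      rw [Finset.sum_add_distrib, ← Finset.sum_div, ← Finset.sum_mul, Finset.sum_const,
        nsmul_eq_mul]
      have h1 : T * ((k : ℝ) + 1) ^ d / (2 * T) = ((k : ℝ) + 1) ^ d / 2 := by
        field_simp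
      have h2 : 2 * ((S.card : ℝ) * (d * (d * k + 2) ^ (d - 1) : ℕ)) ≤ ((k : ℝ) + 1) ^ d := by
        exact_mod_cast hrounding
      rw [h1]
      push_cast at h2 ⊢
      linarith
  refine ⟨k, α, ?_, fun x hx => ?_⟩
  · exact Nat.le_mul_of_pos_right _ (by positivity)
  · have := hα x hx
    rw [div_le_iff₀ (by positivity)] at this
    linarith

end Balancing

end Joints

/-! ### The factorization -/

open Joints in
theorem theorem4 (d : ℕ) (hd : 1 ≤ d) :
    ∃ C : ℝ≥0, ∀ (F : Type*) [Field F] (M : (Fin d → F) → ℝ≥0)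
      (hM : (Function.support M).Finite),
      ∃ g : (Fin d → F) → Joints.Line F d → ℝ≥0,
        (∀ (x : Fin d → F) (l : Fin d → Joints.Line F d),
          M x ^ d * Joints.jointKernel x l ≤ ∏ i, g x (l i)) ∧
        ∀ l : Joints.Line F d,
          Summable (fun x : {x : Fin d → F // x ∈ l.1} => g x.1 l) ∧
          ∑' x : {x : Fin d → F // x ∈ l.1}, g x.1 l ≤
            C * (∑ x ∈ hM.toFinset, M x ^ d) ^ (1 / (d : ℝ)) := by
  classical
  refine ⟨4 * d, fun F _ M hM => ?_⟩
  have hd0 : d ≠ 0 := by omega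
  set S := hM.toFinset with hSdef
  have hS (x : Fin d → F) : x ∈ S ↔ M x ≠ 0 := by simp [hSdef]
  set T : ℝ≥0 := ∑ x ∈ S, M x ^ d with hT
  obtain ⟨k, α, hcard, hα⟩ := exists_handicap_mul_le hd (S := S) (m := fun x => (M x : ℝ) ^ d)
    fun x hx => pow_pos (NNReal.coe_pos.2 (pos_iff_ne_zero.2 ((hS x).1 hx))) d
  have hα' : ∀ x ∈ S, M x ^ d * ((k : ℝ≥0) + 1) ^ d ≤ 2 * T * minDepth S α (d * k) x := by
    intro x hx
    have := hα x hx
    rw [hT]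
    exact_mod_cast this
  set R : ℝ≥0 := T ^ (1 / (d : ℝ)) with hR
  have hRd : R ^ d = T := by
    rw [hR, one_div, NNReal.rpow_inv_natCast_pow _ hd0]
  set c : ℝ≥0 := 2 * R / (k + 1) with hc
  refine ⟨fun x l => if x ∈ pointsOn S l then c * fillDepth (pointsOn S l) α (d * k) x else 0,
    fun x l => ?_, fun l => ?_⟩
  · by_cases hl : FormJoint x l
    swap
    · simp [jointKernel, hl]
    by_cases hx : x ∈ S
    swap
    · simp [not_not.1 (mt (hS x).2 hx), hd0]
    have hmem (i : Fin d) : x ∈ pointsOn S (l i) := mem_pointsOn.2 ⟨hx, hl.1 i⟩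
    simp only [jointKernel, if_pos hl, mul_one, hmem, if_true]
    rw [Finset.prod_mul_distrib, Finset.prod_const, Finset.card_univ, Fintype.card_fin]
    have hk : (0 : ℝ≥0) < ((k : ℝ≥0) + 1) ^ d := by positivity
    have h2 : (2 : ℝ≥0) ≤ 2 ^ d := le_self_pow₀ one_le_two hd0
    have hW : (minDepth S α (d * k) x : ℝ≥0) ≤
        ∏ i, (fillDepth (pointsOn S (l i)) α (d * k) x : ℝ≥0) := by
      exact_mod_cast minDepth_le hl
    rw [hc, div_pow, mul_pow, hRd, div_mul_eq_mul_div, le_div_iff₀ hk]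
    exact (hα' x hx).trans (mul_le_mul' (mul_le_mul_left h2 T) hW)
  · set f : {x : Fin d → F // x ∈ l.1} → ℝ≥0 := fun x =>
      if x.1 ∈ pointsOn S l then c * fillDepth (pointsOn S l) α (d * k) x.1 else 0 with hf
    have hsupp : ∀ x ∉ S.subtype (· ∈ l.1), f x = 0 := by
      intro x hx
      rw [Finset.mem_subtype] at hx
      simp [hf, mem_pointsOn, hx]
    refine ⟨summable_of_ne_finset_zero hsupp, ?_⟩
    rw [tsum_eq_sum hsupp]
    have hk : (k : ℝ≥0) + 1 ≠ 0 := by positivity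
    have hdepth : ∑ x ∈ pointsOn S l, fillDepth (pointsOn S l) α (d * k) x ≤
        2 * d * (k + 1) := by
      have h1 : (pointsOn S l).card ≤ S.card :=
        Finset.card_le_card fun x hx => (mem_pointsOn.1 hx).1
      have := sum_fillDepth_le (Y := pointsOn S l) (α := α) (n := d * k)
      nlinarith
    calc ∑ x ∈ S.subtype (· ∈ l.1), f x
        = ∑ x ∈ pointsOn S l, c * fillDepth (pointsOn S l) α (d * k) x := by
          have : pointsOn S l = S.filter (· ∈ l.1) := by
            ext; simp [mem_pointsOn]
          rw [Finset.sum_subtype_eq_sum_filter (f := fun x => if x ∈ pointsOn S l then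
            c * (fillDepth (pointsOn S l) α (d * k) x : ℝ≥0) else 0), ← this]
          exact Finset.sum_congr rfl fun x hx => if_pos hx
      _ = c * (∑ x ∈ pointsOn S l, fillDepth (pointsOn S l) α (d * k) x : ℕ) := by
          rw [← Finset.mul_sum, Nat.cast_sum]
      _ ≤ c * (2 * d * (k + 1) : ℕ) := by gcongr
      _ = 4 * d * R := by
          rw [hc]
          push_cast
          field_simp
          ring
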